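/- \textbf{Setting.} Let $G$ be a finite directed multigraph (loops and parallel edges allowed) with edge set $E$ and vertices numbered $1,\dots,n$ ($n\ge 1$) so that $(1,2,\dots,n)$ is a Hamiltonian cycle. Edges have lengths $t(e)>0$ that are linearly independent over $\mathbb{Q}$. At time $0$ points start from vertex $1$ along all its outgoing edges with unit speed; whenever one or several points arrive at a vertex, they are replaced by one point on each outgoing edge of this vertex. Let $\mathcal T$ be the set of times at which points enter vertex $1$, $N_1(T)=\#\{s\in\mathcal T: s\le T\}$ and $\beta=|E|-n+1$. For each vertex $v$ fix an \emph{inner} edge from $v$ to the next vertex ($1$ being next to $n$); all other edges are \emph{outer}. The cycle of all inner edges is the \emph{inner cycle}. Fix at each vertex an order of the outgoing edges in which the inner edge is last. \textbf{The algorithm.} Let $H:E\to\mathbb{Z}_{\ge 0}$ be balanced (at each vertex, the sums of $H$ over incoming and over outgoing edges agree). Initially no edge is marked. Step 1: from vertex $1$, walk each time along the first unmarked edge until a vertex is visited again; let $c$ be the simple cycle just closed. Step 2: as long as all labels along $c$ are positive, subtract $1$ along $c$; let $a\ge 0$ be the number of subtractions, and record $(c,a)$. Step 3: if $c$ is the inner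 cycle and all labels along it are zero, stop; otherwise mark the first (in the order of the walk) outer edge of $c$ with label zero and return to Step 1. Let $\sigma(H)$ be the list of recorded pairs $(c,a)$ with $a>0$, in order. For $T=\sum_e H(e)t(e)$ with $H$ balanced ($H$ is determined by $T$) put $\mu(T)=\sigma(H)$. \textbf{Tuples of cycles.} A \emph{complete tuple of generated cycles} is a tuple $(c_1,\dots,c_k)$ such that $c_1$ is obtained by Step 1 without marks, each $c_{j+1}$ is obtained by Step 1 after additionally marking the first unmarked outer edge going out of some vertex of $c_j$, and $c_k$ is the inner cycle. A tuple of \emph{weighted generated cycles} is $((c_1,a_1),\dots,(c_k,a_k))$ with positive integers $a_j$ and $(c_1,\dots,c_k)$ a subsequence of a complete tuple of generated cycles; its time is $t(c)=\sum_j a_j t(c_j)$, where $t(c_j)$ is the length of $c_j$. It is \emph{weighted reachable} if moreover $\mu(t(c))=c$ and $t(c)\in\mathcal T$. Let $D_i$ be the set of all $(d_1,\dots,d_i)$ such that $((d_1,1),\dots,(d_i,1))$ is weighted reachable. \textbf{Theorem.} For every real $T$, \[ N_1(T)=\sum_{i=1}^{\beta}\ \sum_{d\in D_i}\#\Big\{(n_1,\dots,n_i)\in\mathbb{Z}_{>0}^i:\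 \sum_{j=1}^{i}n_j\,t(d_j)\le T\Big\}, \] where $N_1(T)$, all the sets $D_i$ and all the sets of integer tuples on the right are finite. -/

import Mathlib

/-- A directed multigraph (loops and parallel edges allowed) with vertex type `V`
and edge type `E`. -/
structure MultiDigraph (V E : Type*) where
  /-- the vertex an edge leaves -/
  src : E → V
  /-- the vertex an edge arrives at -/
  tgt : E → V

namespace MultiDigraph

/-- The dynamical system. At time `0` one point leaves `start` along every edge issuing from
`start`, all points moving with unit speed. Whenever points arrive at a vertex, they are replaced
by one point on each edge issuing from that vertex.
`G.EntersAt t start v s` says that at time `s` a point enters the vertex `v`,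
where `t e` is the length of the edge `e`. -/
inductive EntersAt {V E : Type*} (G : MultiDigraph V E) (t : E → ℝ) (start : V) : V → ℝ → Prop
  | first (e : E) (h : G.src e = start) : EntersAt G t start (G.tgt e) (t e)
  | next (e : E) (s : ℝ) (h : EntersAt G t start (G.src e) s) :
      EntersAt G t start (G.tgt e) (s + t e)

/-- The set of times at which points enter the vertex `x`. -/
def entryTimes {V E : Type*} (G : MultiDigraph V E) (t : E → ℝ) (start x : V) : Set ℝ :=
  {s | G.EntersAt t start x s}

/-- The number of times `≤ T` at which points enter the vertex `x`. -/
noncomputable def entryCount {V E : Type*} (G : MultiDigraph V E) (t : E → ℝ) (start x : V)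
    (T : ℝ) : ℕ :=
  {s | s ∈ G.entryTimes t start x ∧ s ≤ T}.ncard

/-- The first Betti number `|E| - |V| + 1` (truncated subtraction is harmless for connected
graphs). -/
def betti {V E : Type*} [Fintype V] [Fintype E] (_G : MultiDigraph V E) : ℕ :=
  Fintype.card E + 1 - Fintype.card V

/-- Membership in the set of edge labellings by non-negative integers for which at each vertex
the sum of the incoming labels equals the sum of the outgoing labels. -/
def Balanced {V E : Type*} [DecidableEq V] [Fintype E] (G : MultiDigraph V E) (H : E → ℕ) : Prop :=
  ∀ v, ∑ e with G.tgt e = v, H e = ∑ e with G.src e = v, H e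

/-- The choices made for a Hamiltonian digraph whose vertices are numbered (by `Fin n`, the start
vertex being `0`) along a Hamiltonian cycle: an inner edge from each vertex to the
next one (cyclically), and, at each vertex, an ordering of its outgoing edges in which the inner
edge is the last one. -/
structure HamiltonianOrder {n : ℕ} [NeZero n] {E : Type*} (G : MultiDigraph (Fin n) E) where
  /-- the inner edge leaving a vertex -/
  inner : Fin n → E
  src_inner : ∀ v, G.src (inner v) = v
  tgt_inner : ∀ v, G.tgt (inner v) = v + 1
  /-- the outgoing edges of a vertex in the chosen order -/
  out : Fin n → List E
  nodup_out : ∀ v, (out v).Nodup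
  mem_out : ∀ v e, e ∈ out v ↔ G.src e = v
  getLast_out : ∀ v, (out v).getLast? = some (inner v)

/-- Length (traversal time) of a cycle, a cycle being given by the cyclic list of its edges. -/
def cycleTime {E : Type*} (t : E → ℝ) (c : Cycle E) : ℝ :=
  (c.toMultiset.map t).sum

/-- Time of a tuple of weighted cycles. -/
def tupleTime {E : Type*} (t : E → ℝ) (c : List (Cycle E × ℕ)) : ℝ :=
  (c.map fun p => (p.2 : ℝ) * cycleTime t p.1).sum

namespace HamiltonianOrder

variable {n : ℕ} [NeZero n] {E : Type*} [DecidableEq E] {G : MultiDigraph (Fin n) E}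

/-- An edge is outer if it is not one of the inner edges. -/
def IsOuter (O : HamiltonianOrder G) (e : E) : Prop :=
  e ≠ O.inner (G.src e)

instance (O : HamiltonianOrder G) (e : E) : Decidable (O.IsOuter e) :=
  inferInstanceAs (Decidable (_ ≠ _))

/-- The first unmarked edge issuing from `v`, where `M` is the set of marked edges. (Only outer
edges ever get marked, so that there always is one; the default value is irrelevant.) -/
def firstEdge (O : HamiltonianOrder G) (M : Finset E) (v : Fin n) : E :=
  ((O.out v).find? fun e => decide (e ∉ M)).getD (O.inner v)

/-- The vertex reached after `k` moves when one starts at the start vertex and always walks along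
the first unmarked edge. -/
def walk (O : HamiltonianOrder G) (M : Finset E) (k : ℕ) : Fin n :=
  (fun v => G.tgt (O.firstEdge M v))^[k] 0

theorem exists_return (O : HamiltonianOrder G) (M : Finset E) :
    ∃ m, ∃ j < m, O.walk M j = O.walk M m := by
  obtain ⟨a, b, hab, h⟩ := Finite.exists_ne_map_eq_of_infinite (O.walk M)
  rcases lt_or_gt_of_ne hab with hlt | hlt
  · exact ⟨b, a, hlt, h⟩
  · exact ⟨a, b, hlt, h.symm⟩

/-- The first moment at which the walk arrives at a vertex where it has already been. -/
def returnTime (O : HamiltonianOrder G) (M : Finset E) : ℕ :=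
  Nat.find (O.exists_return M)

/-- The earlier moment at which the walk was at that vertex. -/
def firstVisit (O : HamiltonianOrder G) (M : Finset E) : ℕ :=
  Nat.find (Nat.find_spec (O.exists_return M))

/-- Step 1 of the algorithm: the cycle formed by the walk, as the list of its edges in the order in
which they are walked along. -/
def step1 (O : HamiltonianOrder G) (M : Finset E) : List E :=
  (List.range' (O.firstVisit M) (O.returnTime M - O.firstVisit M)).map fun k =>
    O.firstEdge M (O.walk M k)

/-- The number of times that step 2 subtracts `1` along the edges of `c`, continuing as long as all
labels along `c` are positive: the minimal label on `c`. -/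
def multiplicity (H : E → ℕ) (c : List E) : ℕ :=
  (c.map H).min?.getD 0

/-- The labelling left after step 2. -/
def step2 (H : E → ℕ) (c : List E) : E → ℕ :=
  fun e => if e ∈ c then H e - multiplicity H c else H e

/-- `O.Run M H r`: the splitting algorithm, started with the set `M` of marked edges and the
labelling `H`, stops, and `r` lists the cycles of the successive iterations together with the number
of times (possibly zero) each of them is taken. -/
inductive Run (O : HamiltonianOrder G) : Finset E → (E → ℕ) → List (Cycle E × ℕ) → Prop
  | finish (M : Finset E) (H : E → ℕ)
      (inner : ∀ e ∈ O.step1 M, ¬ O.IsOuter e)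
      (zero : ∀ e ∈ O.step1 M, step2 H (O.step1 M) e = 0) :
      Run O M H [((O.step1 M : Cycle E), multiplicity H (O.step1 M))]
  | mark (M : Finset E) (H : E → ℕ) (e : E) (r : List (Cycle E × ℕ))
      (first : (O.step1 M).find?
        (fun e' => decide (O.IsOuter e' ∧ step2 H (O.step1 M) e' = 0)) = some e)
      (rest : Run O (insert e M) (step2 H (O.step1 M)) r) :
      Run O M H (((O.step1 M : Cycle E), multiplicity H (O.step1 M)) :: r)

/-- The (graph of the) map `σ`: the algorithm, started without marks on `H`, produces `c`
after the cycles that are taken zero times have been dropped. -/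
def Sigma (O : HamiltonianOrder G) (H : E → ℕ) (c : List (Cycle E × ℕ)) : Prop :=
  ∃ r, O.Run ∅ H r ∧ r.filter (fun p => decide (p.2 ≠ 0)) = c

/-- The (graph of the) map `μ = σ ∘ ω`, where `ω(T)` is the balanced labelling of total time `T`
(unique when the edge lengths are linearly independent over `ℚ`). -/
def Mu [Fintype E] (O : HamiltonianOrder G) (t : E → ℝ) (T : ℝ) (c : List (Cycle E × ℕ)) : Prop :=
  ∃ H : E → ℕ, G.Balanced H ∧ ∑ e, (H e : ℝ) * t e = T ∧ O.Sigma H c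

/-- `O.CompleteFrom M l`: with `M` the set of edges marked so far, the cycles `l` are obtained
successively by step 1, where after each cycle `c` except the last some vertex `v` of `c` is chosen
and the first unmarked outer edge issuing from `v` gets marked; the last cycle is the inner one. -/
inductive CompleteFrom (O : HamiltonianOrder G) : Finset E → List (Cycle E) → Prop
  | last (M : Finset E) (inner : ∀ e ∈ O.step1 M, ¬ O.IsOuter e) :
      CompleteFrom O M [(O.step1 M : Cycle E)]
  | mark (M : Finset E) (v : Fin n) (e : E) (l : List (Cycle E))
      (hv : v ∈ (O.step1 M).map G.src)
      (first : (O.out v).find? (fun e' => decide (O.IsOuter e' ∧ e' ∉ M)) = some e)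
      (rest : CompleteFrom O (insert e M) l) :
      CompleteFrom O M ((O.step1 M : Cycle E) :: l)

/-- Tuples of generated cycles: subsequences of complete tuples of generated cycles. -/
def Generated (O : HamiltonianOrder G) (l : List (Cycle E)) : Prop :=
  ∃ full, O.CompleteFrom ∅ full ∧ l.Sublist full

/-- Tuples of weighted generated cycles (the weights are positive integers). -/
def WeightedGenerated (O : HamiltonianOrder G) (c : List (Cycle E × ℕ)) : Prop :=
  O.Generated (c.map Prod.fst) ∧ ∀ p ∈ c, 0 < p.2

/-- Tuples of weighted reachable cycles. -/
def WeightedReachable [Fintype E] (O : HamiltonianOrder G) (t : E → ℝ)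
    (c : List (Cycle E × ℕ)) : Prop :=
  O.WeightedGenerated c ∧ O.Mu t (tupleTime t c) c ∧ tupleTime t c ∈ G.entryTimes t 0 0

/-- Tuples of reachable cycles: those which are weighted reachable with all weights `1`. -/
def Reachable [Fintype E] (O : HamiltonianOrder G) (t : E → ℝ) (l : List (Cycle E)) : Prop :=
  O.WeightedReachable t (l.map fun c => (c, 1))

/-- The set `D_k` of all tuples of reachable cycles with `k` cycles. -/
def D [Fintype E] (O : HamiltonianOrder G) (t : E → ℝ) (k : ℕ) : Set (Fin k → Cycle E) :=
  {d | O.Reachable t (List.ofFn d)}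

end HamiltonianOrder

end MultiDigraph

namespace MultiDigraph

section Balanced

variable {V E : Type*} [DecidableEq V] [Fintype E] {G : MultiDigraph V E}

theorem Balanced.add_left_cancel {H K : E → ℕ}
    (h : G.Balanced (H + K)) (hH : G.Balanced H) : G.Balanced K := by
  intro v
  have h1 := h v
  have h2 := hH v
  simp only [Pi.add_apply, Finset.sum_add_distrib] at h1
  omega

theorem Balanced.nsmul {K : E → ℕ} (h : G.Balanced K) (a : ℕ) :
    G.Balanced (a • K) := by
  intro v
  simp only [Pi.smul_apply, ← Finset.smul_sum, h v]

end Balanced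

section Walks

variable {V E : Type*} [DecidableEq E] (G : MultiDigraph V E)

/-- `G.LabelledWalk u v K`: there is a walk from `u` to `v` that uses each edge `e` exactly `K e`
times. -/
inductive LabelledWalk (u : V) : V → (E → ℕ) → Prop
  | nil : LabelledWalk u u 0
  | snoc (e : E) (K : E → ℕ) (h : LabelledWalk u (G.src e) K) :
      LabelledWalk u (G.tgt e) (K + Pi.single e 1)

variable {G}

theorem LabelledWalk.trans {u v w : V} {K L : E → ℕ} (h : G.LabelledWalk u v K)
    (h' : G.LabelledWalk v w L) : G.LabelledWalk u w (K + L) := by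
  induction h' with
  | nil => simpa using h
  | snoc e L _ ih => rw [← add_assoc]; exact .snoc e _ ih

theorem LabelledWalk.split {u v w : V} {K : E → ℕ} (h : G.LabelledWalk u v K)
    (hw : w = u ∨ ∃ e, 0 < K e ∧ G.tgt e = w) :
    ∃ K₁ K₂, K = K₁ + K₂ ∧ G.LabelledWalk u w K₁ ∧ G.LabelledWalk w v K₂ := by
  induction h with
  | nil =>
    obtain rfl | ⟨e, he, -⟩ := hw
    · exact ⟨0, 0, by simp, .nil, .nil⟩
    · simp at he
  | snoc e K h ih =>
    by_cases hw' : w = u ∨ ∃ e, 0 < K e ∧ G.tgt e = w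
    · obtain ⟨K₁, K₂, rfl, h₁, h₂⟩ := ih hw'
      exact ⟨K₁, K₂ + Pi.single e 1, by rw [add_assoc], h₁, .snoc e _ h₂⟩
    · push Not at hw'
      obtain hwu | ⟨f, hf, hfw⟩ := hw
      · exact absurd hwu hw'.1
      · have hfe : f = e := by
          by_contra hne
          refine hw'.2 f ?_ hfw
          simpa [hne] using hf
        subst hfe
        subst hfw
        exact ⟨_, 0, by simp, .snoc f K h, .nil⟩

theorem LabelledWalk.tgt_visited {u v : V} {K : E → ℕ} (h : G.LabelledWalk u v K) :
    v = u ∨ ∃ e, 0 < K e ∧ G.tgt e = v := by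
  cases h with
  | nil => exact .inl rfl
  | snoc e K h => exact .inr ⟨e, by simp, rfl⟩

theorem LabelledWalk.src_visited {u v : V} {K : E → ℕ} (h : G.LabelledWalk u v K) {e : E}
    (he : 0 < K e) : G.src e = u ∨ ∃ f, 0 < K f ∧ G.tgt f = G.src e := by
  induction h with
  | nil => simp at he
  | snoc f K h ih =>
    have mono : (G.src e = u ∨ ∃ f, 0 < K f ∧ G.tgt f = G.src e) →
        G.src e = u ∨ ∃ g, 0 < (K + Pi.single f 1 : E → ℕ) g ∧ G.tgt g = G.src e := by
      rintro (h | ⟨g, hg, hge⟩)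
      · exact .inl h
      · exact .inr ⟨g, by simp only [Pi.add_apply]; omega, hge⟩
    by_cases hfe : e = f
    · subst hfe
      exact mono h.tgt_visited
    · exact mono (ih (by simpa [hfe] using he))

/-- A closed walk may be started at the source of any of its edges. -/
theorem LabelledWalk.rotate {u : V} {K : E → ℕ} (h : G.LabelledWalk u u K) {e : E}
    (he : 0 < K e) : G.LabelledWalk (G.src e) (G.src e) K := by
  obtain ⟨K₁, K₂, rfl, h₁, h₂⟩ := h.split (h.src_visited he)
  rw [add_comm]
  exact h₂.trans h₁

theorem LabelledWalk.splice {u v w : V} {K L : E → ℕ} (h : G.LabelledWalk u v K)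
    (hw : w = u ∨ ∃ e, 0 < K e ∧ G.tgt e = w) (h' : G.LabelledWalk w w L) :
    G.LabelledWalk u v (K + L) := by
  obtain ⟨K₁, K₂, rfl, h₁, h₂⟩ := h.split hw
  rw [add_right_comm]
  exact (h₁.trans h').trans h₂

/-- A sum of closed walks that has the same support as a closed walk from `s` is the labelling of a
closed walk from `s`. -/
theorem LabelledWalk.of_support_eq {s : V} {H : E → ℕ} (hH : G.LabelledWalk s s H)
    {A : E → ℕ} (hA : G.LabelledWalk s s A) (B : Multiset (E → ℕ))
    (hB : ∀ K ∈ B, K ≠ 0 ∧ ∃ u, G.LabelledWalk u u K)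
    (h₁ : ∀ e, 0 < H e → 0 < A e ∨ ∃ K ∈ B, 0 < K e)
    (h₂ : ∀ K ∈ B, ∀ e, 0 < K e → 0 < H e) : G.LabelledWalk s s (A + B.sum) := by
  classical
  induction hn : B.card generalizing A B with
  | zero =>
    rw [Multiset.card_eq_zero] at hn
    simpa [hn] using hA
  | succ k ih =>
    have key : ∃ K ∈ B, ∃ e, 0 < K e ∧ (G.src e = s ∨ ∃ f, 0 < A f ∧ G.tgt f = G.src e) := by
      by_contra! hcon
      have visited : ∀ {v L}, G.LabelledWalk s v L → L ≤ H →
          v = s ∨ ∃ f, 0 < A f ∧ G.tgt f = v := by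
        intro v L hL
        induction hL with
        | nil => exact fun _ => .inl rfl
        | snoc e L hL ih' =>
          intro hle
          have hv := ih' (le_trans (by simp) hle)
          have hpos : 0 < H e := by have := hle e; simp at this; omega
          rcases h₁ e hpos with hAe | ⟨K, hK, hKe⟩
          · exact .inr ⟨e, hAe, rfl⟩
          · obtain ⟨h3, h4⟩ := hcon K hK e hKe
            rcases hv with hv | ⟨f, hf, hfe⟩
            · exact absurd hv h3
            · exact absurd hfe (h4 f hf)
      obtain ⟨K, hK⟩ := Multiset.card_pos_iff_exists_mem.1 (by omega : 0 < B.card)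
      obtain ⟨e, he⟩ := Function.ne_iff.1 (hB K hK).1
      have he' : 0 < K e := Nat.pos_of_ne_zero he
      obtain ⟨K₁, K₂, hsum, hK₁, -⟩ := hH.split (hH.src_visited (h₂ K hK e he'))
      obtain ⟨h3, h4⟩ := hcon K hK e he'
      rcases visited hK₁ (by rw [hsum]; simp) with hv | ⟨f, hf, hfe⟩
      · exact h3 hv
      · exact h4 f hf hfe
    obtain ⟨K, hK, e, he, hvis⟩ := key
    obtain ⟨u, hu⟩ := (hB K hK).2
    have hBK : B.erase K ≤ B := Multiset.erase_le K B
    have := ih (hA.splice hvis (hu.rotate he)) (B.erase K)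
      (fun L hL => hB L (Multiset.mem_of_le hBK hL))
      (fun f hf => by
        rcases h₁ f hf with h | ⟨L, hL, hLf⟩
        · exact .inl (by simp only [Pi.add_apply]; omega)
        · by_cases hLK : L = K
          · subst hLK
            exact .inl (by simp only [Pi.add_apply]; omega)
          · exact .inr ⟨L, (Multiset.mem_erase_of_ne hLK).2 hL, hLf⟩)
      (fun L hL => h₂ L (Multiset.mem_of_le hBK hL))
      (by rw [Multiset.card_erase_of_mem hK, hn]; rfl)
    rwa [add_assoc, Multiset.sum_erase hK] at this

theorem LabelledWalk.flow [DecidableEq V] [Fintype E] {u v : V} {K : E → ℕ}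
    (h : G.LabelledWalk u v K) (w : V) :
    ∑ e with G.tgt e = w, K e + (if w = u then 1 else 0) =
      ∑ e with G.src e = w, K e + (if w = v then 1 else 0) := by
  induction h with
  | nil => simp
  | snoc e K h ih =>
    have h1 : ∀ f : E → V, ∑ x with f x = w, (K + Pi.single e 1 : E → ℕ) x =
        ∑ x with f x = w, K x + if w = f e then 1 else 0 := by
      intro f
      simp only [Pi.add_apply, Finset.sum_add_distrib]
      simp [eq_comm]
    rw [h1, h1]
    omega

theorem LabelledWalk.balanced [DecidableEq V] [Fintype E] {u : V} {K : E → ℕ}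
    (h : G.LabelledWalk u u K) : G.Balanced K :=
  fun w => Nat.add_right_cancel (h.flow w)

theorem exists_labelledWalk_of_entersAt [Fintype E] {t : E → ℝ} {s v : V} {x : ℝ}
    (h : G.EntersAt t s v x) :
    ∃ K, G.LabelledWalk s v K ∧ K ≠ 0 ∧ ∑ e, (K e : ℝ) * t e = x := by
  have hs : ∀ (K : E → ℕ) (e : E), ∑ f, (((K + Pi.single e 1 : E → ℕ) f : ℕ) : ℝ) * t f =
      ∑ f, (K f : ℝ) * t f + t e := by
    intro K e
    simp [add_mul, Finset.sum_add_distrib, Pi.single_apply]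
  have hne : ∀ (K : E → ℕ) (e : E), (K + Pi.single e 1 : E → ℕ) ≠ 0 := by
    intro K e h
    simpa using congrFun h e
  induction h with
  | first e h => exact ⟨0 + Pi.single e 1, .snoc e 0 (h ▸ .nil), hne _ _, by rw [hs]; simp⟩
  | next e x _ ih =>
    obtain ⟨K, hK, -, hx⟩ := ih
    exact ⟨_, .snoc e K hK, hne _ _, by rw [hs, hx]⟩

theorem LabelledWalk.entersAt [Fintype E] (t : E → ℝ) {s v : V} {K : E → ℕ}
    (h : G.LabelledWalk s v K) (hK : K ≠ 0) : G.EntersAt t s v (∑ e, (K e : ℝ) * t e) := by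
  suffices (K = 0 ∧ v = s) ∨ G.EntersAt t s v (∑ e, (K e : ℝ) * t e) from
    this.resolve_left fun h => hK h.1
  clear hK
  induction h with
  | nil => exact .inl ⟨rfl, rfl⟩
  | snoc e K h ih =>
    right
    have hs : ∑ f, (((K + Pi.single e 1 : E → ℕ) f : ℕ) : ℝ) * t f =
        ∑ f, (K f : ℝ) * t f + t e := by
      simp [add_mul, Finset.sum_add_distrib, Pi.single_apply]
    rw [hs]
    rcases ih with ⟨rfl, hv⟩ | ih
    · simpa using EntersAt.first e hv
    · exact .next e _ ih

end Walks

section Labels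

variable {E : Type*}

/-- Two tuples of weighted cycles consist of the same cycles, with the same weights being
positive. -/
def SameCycles : List (Cycle E × ℕ) → List (Cycle E × ℕ) → Prop :=
  List.Forall₂ fun p q => p.1 = q.1 ∧ (p.2 = 0 ↔ q.2 = 0)

theorem SameCycles.exists_filter_eq {r d : List (Cycle E × ℕ)}
    (h : SameCycles (r.filter fun p => decide (p.2 ≠ 0)) d) :
    ∃ r', SameCycles r r' ∧ (r'.filter fun p => decide (p.2 ≠ 0)) = d := by
  induction r generalizing d with
  | nil =>
    cases h
    exact ⟨[], .nil, rfl⟩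
  | cons p r ih =>
    by_cases hp : p.2 = 0
    · rw [List.filter_cons_of_neg (by simp [hp])] at h
      obtain ⟨r', hr, rfl⟩ := ih h
      exact ⟨p :: r', .cons ⟨rfl, Iff.rfl⟩ hr, List.filter_cons_of_neg (by simp [hp])⟩
    · rw [List.filter_cons_of_pos (by simp [hp])] at h
      cases h with
      | cons hpq h =>
        obtain ⟨r', hr, rfl⟩ := ih h
        refine ⟨_ :: r', .cons hpq hr, List.filter_cons_of_pos ?_⟩
        simpa [hpq.2] using hp

/-- By linear independence, the total time determines the labelling. -/
theorem label_ext [Fintype E] {t : E → ℝ} (ht : LinearIndependent ℚ t) {H K : E → ℕ}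
    (h : ∑ e, (H e : ℝ) * t e = ∑ e, (K e : ℝ) * t e) : H = K := by
  rw [Fintype.linearIndependent_iff] at ht
  funext e
  have := ht (fun e => (H e : ℚ) - K e) (by
    simp only [sub_smul, Finset.sum_sub_distrib, Rat.smul_def, Rat.cast_natCast, h, sub_self]) e
  exact_mod_cast sub_eq_zero.1 this

theorem tupleTime_ofFn {i : ℕ} (t : E → ℝ) (d : Fin i → Cycle E) (m : Fin i → ℕ) :
    tupleTime t (List.ofFn fun j => (d j, m j)) = ∑ j, (m j : ℝ) * cycleTime t (d j) := by
  rw [tupleTime, List.map_ofFn, List.sum_ofFn]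
  rfl

theorem sameCycles_ofFn {i : ℕ} {d : Fin i → Cycle E} {m m' : Fin i → ℕ}
    (h : ∀ j, m j = 0 ↔ m' j = 0) :
    SameCycles (List.ofFn fun j => (d j, m j)) (List.ofFn fun j => (d j, m' j)) := by
  rw [SameCycles, List.forall₂_iff_get]
  refine ⟨by simp, fun j h1 h2 => ?_⟩
  simp [h]

variable [DecidableEq E]

/-- The number of times each edge occurs in a cycle. -/
def cycleLabel (c : Cycle E) (e : E) : ℕ := c.toMultiset.count e

/-- The edge labelling that is the sum of the weighted cycles. -/
def tupleLabel (c : List (Cycle E × ℕ)) : E → ℕ := (c.map fun p => p.2 • cycleLabel p.1).sum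

@[simp] theorem tupleLabel_nil : tupleLabel ([] : List (Cycle E × ℕ)) = 0 := rfl

@[simp] theorem tupleLabel_cons (p : Cycle E × ℕ) (c : List (Cycle E × ℕ)) :
    tupleLabel (p :: c) = p.2 • cycleLabel p.1 + tupleLabel c := by
  simp [tupleLabel]

theorem cycleLabel_coe (l : List E) (e : E) : cycleLabel (l : Cycle E) e = l.count e := by
  simp [cycleLabel]

theorem cycleLabel_coe_of_nodup {l : List E} (hl : l.Nodup) (e : E) :
    cycleLabel (l : Cycle E) e = if e ∈ l then 1 else 0 := by
  rw [cycleLabel_coe, hl.count]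

theorem cycleTime_eq [Fintype E] (t : E → ℝ) (c : Cycle E) :
    cycleTime t c = ∑ e, (cycleLabel c e : ℝ) * t e := by
  rw [cycleTime, Finset.sum_multiset_map_count]
  simp only [nsmul_eq_mul, cycleLabel]
  refine Finset.sum_subset (Finset.subset_univ _) fun e _ he => ?_
  rw [Multiset.mem_toFinset, ← Multiset.count_eq_zero] at he
  simp [he]

theorem tupleTime_eq [Fintype E] (t : E → ℝ) (c : List (Cycle E × ℕ)) :
    tupleTime t c = ∑ e, (tupleLabel c e : ℝ) * t e := by
  induction c with
  | nil => simp [tupleTime]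
  | cons p c ih =>
    have : tupleTime t (p :: c) = p.2 * cycleTime t p.1 + tupleTime t c := by simp [tupleTime]
    rw [this, ih, cycleTime_eq]
    simp [add_mul, Finset.sum_add_distrib, Finset.mul_sum, mul_assoc]

theorem tupleLabel_eq_zero_iff (c : List (Cycle E × ℕ)) (e : E) :
    tupleLabel c e = 0 ↔ ∀ p ∈ c, p.2 = 0 ∨ cycleLabel p.1 e = 0 := by
  induction c with
  | nil => simp
  | cons p c ih => simp [ih]

theorem tupleLabel_filter (c : List (Cycle E × ℕ)) :
    tupleLabel (c.filter fun p => decide (p.2 ≠ 0)) = tupleLabel c := by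
  induction c with
  | nil => rfl
  | cons p c ih =>
    by_cases hp : p.2 = 0
    · simp_all
    · simp_all

theorem SameCycles.tupleLabel_eq_zero_iff {c d : List (Cycle E × ℕ)} (h : SameCycles c d)
    (e : E) : tupleLabel c e = 0 ↔ tupleLabel d e = 0 := by
  induction h with
  | nil => rfl
  | cons h _ ih => simp [ih, h.1, h.2]

theorem exists_multiset_sum_eq_tupleLabel (c : List (Cycle E × ℕ)) :
    ∃ B : Multiset (E → ℕ), B.sum = tupleLabel c ∧
      ∀ K, K ∈ B ↔ ∃ p ∈ c, p.2 ≠ 0 ∧ K = cycleLabel p.1 := by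
  induction c with
  | nil => exact ⟨0, by simp, by simp⟩
  | cons p c ih =>
    obtain ⟨B, hB, hmem⟩ := ih
    refine ⟨Multiset.replicate p.2 (cycleLabel p.1) + B, by simp [hB], fun K => ?_⟩
    simp [hmem, Multiset.mem_replicate]

theorem finite_setOf_sum_mul_le {ι : Type*} [Fintype ι] {w : ι → ℝ} (hw : ∀ i, 0 < w i) (T : ℝ) :
    {m : ι → ℕ | ∑ i, (m i : ℝ) * w i ≤ T}.Finite := by
  classical
  refine (Set.finite_Iic fun i => ⌈T / w i⌉₊).subset fun m hm i => ?_
  have h1 : (m i : ℝ) * w i ≤ T :=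
    (Finset.single_le_sum (f := fun i => (m i : ℝ) * w i)
      (fun j _ => mul_nonneg (Nat.cast_nonneg _) (hw j).le) (Finset.mem_univ i)).trans hm
  have h2 : (m i : ℝ) ≤ ⌈T / w i⌉₊ := ((le_div_iff₀ (hw i)).2 h1).trans (Nat.le_ceil _)
  exact_mod_cast h2

end Labels

namespace HamiltonianOrder

section Step1

variable {n : ℕ} [NeZero n] {E : Type*} [DecidableEq E] {G : MultiDigraph (Fin n) E}
  (O : G.HamiltonianOrder)

@[simp] theorem src_firstEdge (M : Finset E) (v : Fin n) : G.src (O.firstEdge M v) = v := by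
  unfold firstEdge
  cases h : (O.out v).find? fun e => decide (e ∉ M) with
  | none => exact O.src_inner v
  | some e => exact (O.mem_out v e).1 (List.mem_of_find?_eq_some h)

theorem find?_eq_some_firstEdge {M : Finset E} {v : Fin n} (h : O.firstEdge M v ≠ O.inner v) :
    (O.out v).find? (fun e => decide (e ∉ M)) = some (O.firstEdge M v) := by
  unfold firstEdge at h ⊢
  cases h' : (O.out v).find? fun e => decide (e ∉ M) with
  | none => exact absurd (by rw [h', Option.getD_none]) h
  | some e => simp

theorem firstEdge_notMem {M : Finset E} {v : Fin n} (h : O.firstEdge M v ≠ O.inner v) :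
    O.firstEdge M v ∉ M := by
  simpa using List.find?_some (O.find?_eq_some_firstEdge h)

/-- If the first unmarked edge at a vertex is inner, then all outer edges there are marked. -/
theorem mem_of_firstEdge_eq_inner {M : Finset E} {v : Fin n} (h : O.firstEdge M v = O.inner v)
    {e : E} (he : G.src e = v) (hne : e ≠ O.inner v) : e ∈ M := by
  have hmem : e ∈ O.out v := (O.mem_out v e).2 he
  unfold firstEdge at h
  cases h' : (O.out v).find? fun e => decide (e ∉ M) with
  | none => simpa using List.find?_eq_none.1 h' e hmem
  | some f =>
    rw [h', Option.getD_some] at h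
    subst h
    obtain ⟨-, as, bs, hout, has⟩ := List.find?_eq_some_iff_append.1 h'
    have hnd := O.nodup_out v
    have hlast := O.getLast_out v
    rw [hout] at hmem hnd hlast
    have hbs : bs = [] := by
      by_contra hbs
      rw [List.getLast?_append_cons, List.getLast?_cons] at hlast
      have hl : bs.getLast? = some (bs.getLast hbs) := List.getLast?_eq_some_getLast hbs
      rw [hl] at hlast
      simp only [Option.getD_some, Option.some.injEq] at hlast
      have h1 := List.getLast_mem hbs
      rw [hlast] at h1
      exact (List.nodup_cons.1 hnd.of_append_right).1 h1
    subst hbs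
    simp only [List.mem_append, List.mem_singleton, hne, or_false] at hmem
    simpa using has e hmem

theorem walk_succ (M : Finset E) (k : ℕ) :
    O.walk M (k + 1) = G.tgt (O.firstEdge M (O.walk M k)) := by
  simp only [walk, Function.iterate_succ_apply']

theorem firstVisit_spec (M : Finset E) : O.firstVisit M < O.returnTime M ∧
    O.walk M (O.firstVisit M) = O.walk M (O.returnTime M) :=
  Nat.find_spec (Nat.find_spec (O.exists_return M))

theorem walk_injOn (M : Finset E) : Set.InjOn (O.walk M) (Set.Iio (O.returnTime M)) := by
  have h : ∀ a b, a < b → b < O.returnTime M → O.walk M a ≠ O.walk M b := fun a b hab hb heq =>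
    Nat.find_min (O.exists_return M) hb ⟨a, hab, heq⟩
  intro a ha b hb hab
  rcases lt_trichotomy a b with h' | h' | h'
  · exact absurd hab (h a b h' hb)
  · exact h'
  · exact absurd hab.symm (h b a h' ha)

theorem nodup_step1 (M : Finset E) : (O.step1 M).Nodup := by
  refine List.Nodup.map_on (fun a ha b hb hab => ?_) List.nodup_range'
  rw [List.mem_range'_1] at ha hb
  have h := congrArg G.src hab
  rw [src_firstEdge, src_firstEdge] at h
  exact O.walk_injOn M (by simp; omega) (by simp; omega) h

theorem step1_ne_nil (M : Finset E) : O.step1 M ≠ [] := by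
  have := (O.firstVisit_spec M).1
  simp [step1]
  omega

theorem eq_firstEdge_of_mem_step1 {M : Finset E} {e : E} (he : e ∈ O.step1 M) :
    e = O.firstEdge M (G.src e) := by
  simp only [step1, List.mem_map] at he
  obtain ⟨k, -, rfl⟩ := he
  simp

theorem exists_labelledWalk_step1 (M : Finset E) :
    ∃ u, G.LabelledWalk u u (cycleLabel (O.step1 M : Cycle E)) := by
  have h : ∀ a k, G.LabelledWalk (O.walk M a) (O.walk M (a + k))
      (fun e => ((List.range' a k).map fun k => O.firstEdge M (O.walk M k)).count e) := by
    intro a k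
    induction k with
    | zero => exact .nil
    | succ k ih =>
      rw [← add_assoc, walk_succ]
      convert LabelledWalk.snoc (O.firstEdge M (O.walk M (a + k))) _
        (by rw [src_firstEdge]; exact ih) using 1
      funext e
      rw [List.range'_concat, List.map_append, List.count_append]
      simp only [Pi.add_apply, Pi.single_apply, List.map_singleton, List.count_singleton,
        beq_iff_eq, one_mul, eq_comm (a := e)]
  have hs := O.firstVisit_spec M
  refine ⟨O.walk M (O.firstVisit M), ?_⟩
  have := h (O.firstVisit M) (O.returnTime M - O.firstVisit M)
  rw [Nat.add_sub_cancel' hs.1.le, ← hs.2] at this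
  convert this using 1
  funext e
  rw [cycleLabel_coe, step1]

theorem balanced_step1 [Fintype E] (M : Finset E) :
    G.Balanced (cycleLabel (O.step1 M : Cycle E)) :=
  (O.exists_labelledWalk_step1 M).choose_spec.balanced

theorem cycleLabel_step1 (M : Finset E) (e : E) :
    cycleLabel (O.step1 M : Cycle E) e = if e ∈ O.step1 M then 1 else 0 :=
  cycleLabel_coe_of_nodup (O.nodup_step1 M) e

theorem exists_mem_step1_tgt_eq [Fintype E] {M : Finset E} {e : E} (he : e ∈ O.step1 M) :
    ∃ f ∈ O.step1 M, G.tgt f = G.src e := by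
  have h := O.balanced_step1 M (G.src e)
  have hpos : 0 < ∑ f with G.src f = G.src e, cycleLabel (O.step1 M : Cycle E) f :=
    Finset.sum_pos' (fun _ _ => Nat.zero_le _) ⟨e, by simp, by simp [cycleLabel_step1, he]⟩
  rw [← h] at hpos
  obtain ⟨f, hf, hf'⟩ := Finset.exists_ne_zero_of_sum_ne_zero hpos.ne'
  refine ⟨f, ?_, (Finset.mem_filter.1 hf).2⟩
  by_contra hcon
  exact hf' (by simp [cycleLabel_step1, hcon])

end Step1

section Step2

variable {E : Type*} (H : E → ℕ)

theorem multiplicity_eq_iff {l : List E} (hl : l ≠ []) (a : ℕ) :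
    multiplicity H l = a ↔ (∃ e ∈ l, H e = a) ∧ ∀ e ∈ l, a ≤ H e := by
  obtain ⟨b, hb⟩ : ∃ b, (l.map H).min? = some b := by
    rw [← Option.ne_none_iff_exists']
    simpa using hl
  have hb' := hb
  rw [List.min?_eq_some_iff] at hb'
  simp only [List.mem_map, forall_exists_index, and_imp, forall_apply_eq_imp_iff₂] at hb'
  simp only [multiplicity, hb, Option.getD_some]
  refine ⟨by rintro rfl; exact hb', fun h => ?_⟩
  obtain ⟨⟨e, he, rfl⟩, h1⟩ := h
  obtain ⟨⟨f, hf, rfl⟩, h2⟩ := hb'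
  exact le_antisymm (h2 e he) (h1 f hf)

theorem multiplicity_le {l : List E} {e : E} (he : e ∈ l) : multiplicity H l ≤ H e :=
  ((multiplicity_eq_iff H (List.ne_nil_of_mem he) _).1 rfl).2 e he

variable [DecidableEq E]

theorem exists_step2_eq_zero {l : List E} (hl : l ≠ []) : ∃ e ∈ l, step2 H l e = 0 := by
  obtain ⟨⟨e, he, h⟩, -⟩ := (multiplicity_eq_iff H hl _).1 rfl
  exact ⟨e, he, by simp [step2, he, h]⟩

theorem step2_le (l : List E) (e : E) : step2 H l e ≤ H e := by
  unfold step2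
  split <;> omega

theorem multiplicity_smul_add_step2 {l : List E} (hl : l.Nodup) :
    multiplicity H l • cycleLabel (l : Cycle E) + step2 H l = H := by
  funext e
  simp only [Pi.add_apply, Pi.smul_apply, smul_eq_mul, cycleLabel_coe_of_nodup hl, step2]
  by_cases he : e ∈ l
  · have := multiplicity_le H he
    simp only [he, if_true]
    omega
  · simp [he]

theorem multiplicity_and_step2_eq {l : List E} (hl : l.Nodup) (hne : l ≠ []) (a : ℕ)
    {K : E → ℕ} (hK : ∃ e ∈ l, K e = 0) :
    multiplicity (a • cycleLabel (l : Cycle E) + K) l = a ∧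
      step2 (a • cycleLabel (l : Cycle E) + K) l = K := by
  have h : multiplicity (a • cycleLabel (l : Cycle E) + K) l = a := by
    rw [multiplicity_eq_iff _ hne]
    obtain ⟨e, he, heK⟩ := hK
    exact ⟨⟨e, he, by simp [cycleLabel_coe_of_nodup hl, he, heK]⟩,
      fun f hf => by simp [cycleLabel_coe_of_nodup hl, hf]⟩
  refine ⟨h, funext fun e => ?_⟩
  simp only [step2, h, Pi.add_apply, Pi.smul_apply, smul_eq_mul, cycleLabel_coe_of_nodup hl]
  split <;> simp

end Step2

section Run

variable {n : ℕ} [NeZero n] {E : Type*} [DecidableEq E] {G : MultiDigraph (Fin n) E}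
  {O : G.HamiltonianOrder}

theorem forall_of_sub_one {P : Fin n → Prop} {v : Fin n} (hv : P v)
    (h : ∀ w, P (w + 1) → P w) (w : Fin n) : P w := by
  have h' : ∀ k : ℕ, P (v - Fin.ofNat n k) := by
    intro k
    induction k with
    | zero => simpa using hv
    | succ k ih =>
      refine h _ ?_
      convert ih using 1
      have : Fin.ofNat n (k + 1) = Fin.ofNat n k + 1 := by
        apply Fin.ext
        simp [Fin.val_add, Fin.ofNat]
      rw [this]
      abel
  have := h' (v - w).val
  simpa using this

/-- A set of inner edges contained in the cycle of step 1 that is closed under passing to the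
preceding edge of that cycle contains all inner edges. -/
theorem forall_inner_of_predecessor [Fintype E] {M : Finset E} {P : E → Prop}
    (hinner : ∀ e ∈ O.step1 M, P e → ¬ O.IsOuter e)
    (hpred : ∀ e ∈ O.step1 M, P e → ∀ f ∈ O.step1 M, G.tgt f = G.src e → P f)
    (hex : ∃ e ∈ O.step1 M, P e) (v : Fin n) :
    O.firstEdge M v = O.inner v ∧ O.inner v ∈ O.step1 M ∧ P (O.inner v) := by
  have heq : ∀ e ∈ O.step1 M, P e → e = O.inner (G.src e) := fun e he hP =>
    not_not.1 (hinner e he hP)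
  have key : O.inner v ∈ O.step1 M ∧ P (O.inner v) := by
    obtain ⟨e, he, hPe⟩ := hex
    refine forall_of_sub_one (P := fun v => O.inner v ∈ O.step1 M ∧ P (O.inner v))
      (v := G.src e) (by rw [← heq e he hPe]; exact ⟨he, hPe⟩) (fun w hw => ?_) v
    obtain ⟨f, hf, hft⟩ := O.exists_mem_step1_tgt_eq hw.1
    have hPf := hpred _ hw.1 hw.2 f hf hft
    have hfi := heq f hf hPf
    rw [O.src_inner, hfi, O.tgt_inner] at hft
    rw [← add_right_cancel hft, ← hfi]
    exact ⟨hf, hPf⟩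
  refine ⟨?_, key⟩
  have := O.eq_firstEdge_of_mem_step1 key.1
  rw [O.src_inner] at this
  exact this.symm

theorem Run.eq {M : Finset E} {H : E → ℕ} {r r' : List (Cycle E × ℕ)} (h : O.Run M H r)
    (h' : O.Run M H r') : r = r' := by
  induction h generalizing r' with
  | finish M H inner zero =>
    cases h' with
    | finish => rfl
    | mark _ _ e r first _ =>
      have := List.find?_some first
      simp only [decide_eq_true_eq] at this
      exact absurd this.1 (inner e (List.mem_of_find?_eq_some first))
  | mark M H e r first rest ih =>
    cases h' with
    | finish _ _ inner zero =>
      have := List.find?_some first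
      simp only [decide_eq_true_eq] at this
      exact absurd this.1 (inner e (List.mem_of_find?_eq_some first))
    | mark _ _ e' r' first' rest' =>
      obtain rfl : e = e' := Option.some.inj (first.symm.trans first')
      rw [ih rest']

theorem Run.tupleLabel_eq [Fintype E] {M : Finset E} {H : E → ℕ} {r : List (Cycle E × ℕ)}
    (h : O.Run M H r) (hM : ∀ e ∈ M, H e = 0) : tupleLabel r = H := by
  induction h with
  | finish M H inner zero =>
    have hall := forall_inner_of_predecessor (O := O) (M := M) (P := fun _ => True)
      (fun e he _ => inner e he) (fun _ _ _ _ _ _ => trivial)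
      (by simpa using List.exists_mem_of_ne_nil _ (O.step1_ne_nil M))
    have h0 : step2 H (O.step1 M) = 0 := by
      funext e
      by_cases he : e = O.inner (G.src e)
      · exact zero e (he ▸ (hall _).2.1)
      · have := step2_le H (O.step1 M) e
        rw [hM e (O.mem_of_firstEdge_eq_inner (hall (G.src e)).1 rfl he)] at this
        exact Nat.le_zero.1 this
    rw [tupleLabel_cons, tupleLabel_nil, ← h0]
    exact multiplicity_smul_add_step2 H (O.nodup_step1 M)
  | mark M H e r first rest ih =>
    rw [tupleLabel_cons, ih]
    · exact multiplicity_smul_add_step2 H (O.nodup_step1 M)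
    · intro f hf
      rcases Finset.mem_insert.1 hf with rfl | hf
      · have := List.find?_some first
        simp only [decide_eq_true_eq] at this
        exact this.2
      · have := step2_le H (O.step1 M) f
        rw [hM f hf] at this
        exact Nat.le_zero.1 this

/-- The course of the algorithm depends only on which of the weights are positive. -/
theorem Run.reweight [Fintype E] {M : Finset E} {H : E → ℕ} {r r' : List (Cycle E × ℕ)}
    (h : O.Run M H r) (hM : ∀ e ∈ M, H e = 0) (hr : SameCycles r r') :
    O.Run M (tupleLabel r') r' := by
  induction h generalizing r' with
  | finish M H inner zero =>
    cases hr with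
    | @cons _ q _ _ hq hr =>
      cases hr
      obtain ⟨c, a⟩ := q
      obtain ⟨rfl, -⟩ := hq
      obtain ⟨e, he⟩ := List.exists_mem_of_ne_nil _ (O.step1_ne_nil M)
      obtain ⟨h1, h2⟩ := multiplicity_and_step2_eq (O.nodup_step1 M) (O.step1_ne_nil M) a
        (K := 0) ⟨e, he, rfl⟩
      have := Run.finish M (a • cycleLabel (O.step1 M : Cycle E) + 0) inner
        (by intro f _; rw [h2]; rfl)
      rw [h1] at this
      simpa using this
  | mark M H e r first rest ih =>
    have hM' : ∀ f ∈ insert e M, step2 H (O.step1 M) f = 0 := by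
      intro f hf
      rcases Finset.mem_insert.1 hf with rfl | hf
      · have := List.find?_some first
        simp only [decide_eq_true_eq] at this
        exact this.2
      · have := step2_le H (O.step1 M) f
        rw [hM f hf] at this
        exact Nat.le_zero.1 this
    cases hr with
    | @cons _ q _ r' hq hr =>
      obtain ⟨c, a⟩ := q
      obtain ⟨rfl, -⟩ := hq
      have hzero : ∀ f, step2 H (O.step1 M) f = 0 ↔ tupleLabel r' f = 0 := fun f => by
        rw [← SameCycles.tupleLabel_eq_zero_iff hr, rest.tupleLabel_eq hM']
      obtain ⟨h1, h2⟩ := multiplicity_and_step2_eq (O.nodup_step1 M) (O.step1_ne_nil M) a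
        (K := tupleLabel r')
        ⟨e, List.mem_of_find?_eq_some first, (hzero e).1 (hM' e (Finset.mem_insert_self _ _))⟩
      have := Run.mark M (a • cycleLabel (O.step1 M : Cycle E) + tupleLabel r') e r'
        (by rw [h2]; simpa only [hzero] using first) (by rw [h2]; exact ih hM' hr)
      rw [h1] at this
      rwa [tupleLabel_cons]

theorem exists_run [Fintype E] {M : Finset E} {H : E → ℕ} (hH : G.Balanced H)
    (hM : ∀ e ∈ M, H e = 0) : ∃ r, O.Run M H r := by
  induction hk : Mᶜ.card generalizing M H with
  | zero =>
    have hmem : ∀ e, e ∈ M := by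
      simpa [Finset.eq_univ_iff_forall] using hk
    refine ⟨_, .finish M H (fun e he hout => ?_) fun e _ =>
      Nat.le_zero.1 ((step2_le H _ e).trans (hM e (hmem e)).le)⟩
    rw [O.eq_firstEdge_of_mem_step1 he] at hout
    exact O.firstEdge_notMem (by simpa [IsOuter] using hout) (hmem _)
  | succ k ih =>
    have hM' : ∀ e ∈ M, step2 H (O.step1 M) e = 0 := fun e he =>
      Nat.le_zero.1 ((step2_le H _ e).trans (hM e he).le)
    have hbal : G.Balanced (step2 H (O.step1 M)) := by
      refine Balanced.add_left_cancel ?_ ((O.balanced_step1 M).nsmul (multiplicity H (O.step1 M)))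
      rwa [multiplicity_smul_add_step2 H (O.nodup_step1 M)]
    cases hfind : (O.step1 M).find?
        (fun e' => decide (O.IsOuter e' ∧ step2 H (O.step1 M) e' = 0)) with
    | some e =>
      have he := List.find?_some hfind
      simp only [decide_eq_true_eq] at he
      have hfe := O.eq_firstEdge_of_mem_step1 (List.mem_of_find?_eq_some hfind)
      have heM : e ∉ M := by
        rw [hfe]
        refine O.firstEdge_notMem ?_
        rw [← hfe]
        exact he.1
      obtain ⟨r, hr⟩ := ih (M := insert e M) hbal
        (by simpa [he.2] using hM')
        (by rw [Finset.compl_insert, Finset.card_erase_of_mem (by simpa using heM), hk]; rfl)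
      exact ⟨_, .mark M H e r hfind hr⟩
    | none =>
      have hinner : ∀ e ∈ O.step1 M, step2 H (O.step1 M) e = 0 → ¬ O.IsOuter e := by
        intro e he h0 hout
        have := List.find?_eq_none.1 hfind e he
        simp [hout, h0] at this
      have hall := forall_inner_of_predecessor (O := O) (M := M)
        (P := fun e => step2 H (O.step1 M) e = 0) hinner
        (fun e he h0 f hf hft => by
          have hfe := O.eq_firstEdge_of_mem_step1 he
          have hi : O.firstEdge M (G.src e) = O.inner (G.src e) :=
            hfe ▸ not_not.1 (hinner e he h0)
          have hsum := hbal (G.src e)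
          rw [Finset.sum_eq_zero (s := Finset.univ.filter fun f => G.src f = G.src e)] at hsum
          · exact Finset.sum_eq_zero_iff.1 hsum f (by simpa using hft)
          · intro g hg
            have hg : G.src g = G.src e := by simpa using hg
            by_cases hgi : g = O.inner (G.src e)
            · rw [hgi, ← hi, ← hfe, h0]
            · exact hM' g (O.mem_of_firstEdge_eq_inner hi hg hgi))
        (exists_step2_eq_zero H (O.step1_ne_nil M))
      have heq : ∀ e ∈ O.step1 M, e = O.inner (G.src e) := fun e he =>
        (O.eq_firstEdge_of_mem_step1 he).trans (hall _).1
      exact ⟨_, .finish M H (fun e he h => h (heq e he)) fun e he => heq e he ▸ (hall _).2.2⟩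

theorem Run.completeFrom {M : Finset E} {H : E → ℕ} {r : List (Cycle E × ℕ)}
    (h : O.Run M H r) : O.CompleteFrom M (r.map Prod.fst) := by
  induction h with
  | finish M H inner zero => exact .last M inner
  | mark M H e r first rest ih =>
    have hmem := List.mem_of_find?_eq_some first
    have hout := List.find?_some first
    simp only [decide_eq_true_eq] at hout
    have hfe := O.eq_firstEdge_of_mem_step1 hmem
    refine .mark M (G.src e) e _ (List.mem_map_of_mem hmem) ?_ ih
    have hfind := O.find?_eq_some_firstEdge (M := M) (v := G.src e) (hfe ▸ hout.1)
    rw [← hfe, List.find?_eq_some_iff_append] at hfind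
    obtain ⟨heM, as, bs, hsplit, has⟩ := hfind
    rw [List.find?_eq_some_iff_append]
    refine ⟨by simpa [hout.1] using heM, as, bs, hsplit, fun f hf => ?_⟩
    have := has f hf
    simp only [Bool.not_eq_true', decide_eq_false_iff_not, not_not] at this
    simp [this]

theorem CompleteFrom.mem_range {M : Finset E} {l : List (Cycle E)} (h : O.CompleteFrom M l)
    {c : Cycle E} (hc : c ∈ l) : ∃ M, c = (O.step1 M : Cycle E) := by
  induction h with
  | last M _ => exact ⟨M, by simpa using hc⟩
  | mark M v e l _ _ _ ih =>
    rcases List.mem_cons.1 hc with h | h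
    · exact ⟨M, h⟩
    · exact ih h

theorem Generated.mem_range {l : List (Cycle E)} (h : O.Generated l) {c : Cycle E} (hc : c ∈ l) :
    ∃ M, c = (O.step1 M : Cycle E) := by
  obtain ⟨full, hfull, hl⟩ := h
  exact hfull.mem_range (hl.subset hc)

theorem CompleteFrom.length_le [Fintype E] {M : Finset E} {l : List (Cycle E)}
    (h : O.CompleteFrom M l) (hM : ∀ e ∈ M, O.IsOuter e) :
    l.length + M.card ≤ (Finset.univ.filter O.IsOuter).card + 1 := by
  induction h with
  | last M _ =>
    have : M.card ≤ (Finset.univ.filter O.IsOuter).card :=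
      Finset.card_le_card fun e he => by simpa using hM e he
    simp
    omega
  | mark M v e l _ first _ ih =>
    have he := List.find?_some first
    simp only [decide_eq_true_eq] at he
    have := ih (by simpa [he.1] using hM)
    rw [Finset.card_insert_of_notMem he.2] at this
    simp only [List.length_cons]
    omega

theorem card_isOuter_add [Fintype E] (O : G.HamiltonianOrder) :
    (Finset.univ.filter O.IsOuter).card + n = Fintype.card E := by
  have hinj : Function.Injective O.inner := fun v w h => by
    rw [← O.src_inner v, h, O.src_inner]
  have h := Finset.card_filter_add_card_filter_not (s := Finset.univ) O.IsOuter
  have himg : (Finset.univ.filter fun e => ¬ O.IsOuter e) = Finset.univ.image O.inner := by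
    ext e
    simp only [IsOuter, not_not, Finset.mem_filter_univ, Finset.mem_image, Finset.mem_univ,
      true_and]
    exact ⟨fun h => ⟨_, h.symm⟩, by rintro ⟨v, rfl⟩; rw [O.src_inner]⟩
  rw [himg, Finset.card_image_of_injective _ hinj, Finset.card_univ, Finset.card_univ,
    Fintype.card_fin] at h
  exact h

end Run

section Reachable

variable {n : ℕ} [NeZero n] {E : Type*} [Fintype E] [DecidableEq E] {G : MultiDigraph (Fin n) E}
  {O : G.HamiltonianOrder} {t : E → ℝ}

theorem Mu.eq (ht : LinearIndependent ℚ t) {T : ℝ} {c d : List (Cycle E × ℕ)}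
    (hc : O.Mu t T c) (hd : O.Mu t T d) : c = d := by
  obtain ⟨H, -, hH, r, hr, rfl⟩ := hc
  obtain ⟨K, -, hK, r', hr', rfl⟩ := hd
  obtain rfl := label_ext ht (hH.trans hK.symm)
  rw [hr.eq hr']

theorem weightedReachable_iff (ht : LinearIndependent ℚ t) {c : List (Cycle E × ℕ)} :
    O.WeightedReachable t c ↔ O.Sigma (tupleLabel c) c ∧
      G.LabelledWalk 0 0 (tupleLabel c) ∧ tupleLabel c ≠ 0 := by
  constructor
  · rintro ⟨-, ⟨H, -, hH, hsig⟩, henter⟩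
    obtain ⟨K, hK, hK0, hKt⟩ := exists_labelledWalk_of_entersAt henter
    rw [tupleTime_eq] at hH hKt
    obtain rfl := label_ext ht hH
    obtain rfl := label_ext ht hKt
    exact ⟨hsig, hK, hK0⟩
  · rintro ⟨hsig, hwalk, h0⟩
    refine ⟨?_, ⟨_, hwalk.balanced, (tupleTime_eq t c).symm, hsig⟩, ?_⟩
    · obtain ⟨r, hr, hrc⟩ := hsig
      rw [← hrc]
      refine ⟨⟨_, hr.completeFrom, List.filter_sublist.map _⟩, fun p hp => ?_⟩
      simpa [Nat.pos_iff_ne_zero] using (List.mem_filter.1 hp).2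
    · rw [tupleTime_eq]
      exact hwalk.entersAt t h0

theorem exists_weightedReachable (ht : LinearIndependent ℚ t) (O : G.HamiltonianOrder) {s : ℝ}
    (hs : s ∈ G.entryTimes t 0 0) : ∃ c, O.WeightedReachable t c ∧ tupleTime t c = s := by
  obtain ⟨K, hK, hK0, rfl⟩ := exists_labelledWalk_of_entersAt hs
  obtain ⟨r, hr⟩ := exists_run (O := O) (M := ∅) hK.balanced (by simp)
  have hrK := (tupleLabel_filter r).trans (hr.tupleLabel_eq (by simp))
  refine ⟨_, (weightedReachable_iff ht).2 ?_, by rw [tupleTime_eq, hrK]⟩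
  rw [hrK]
  exact ⟨⟨r, hr, rfl⟩, hK, hK0⟩

/-- Reachability of a tuple of weighted cycles does not depend on the weights. -/
theorem WeightedReachable.of_sameCycles (ht : LinearIndependent ℚ t) {c d : List (Cycle E × ℕ)}
    (hc : O.WeightedReachable t c) (h : SameCycles c d) : O.WeightedReachable t d := by
  rw [weightedReachable_iff ht] at hc ⊢
  obtain ⟨⟨r, hr, rfl⟩, hwalk, h0⟩ := hc
  have hz := h.tupleLabel_eq_zero_iff
  obtain ⟨r', hrr', rfl⟩ := h.exists_filter_eq
  have hr' := hr.reweight (by simp) hrr'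
  refine ⟨⟨r', by rwa [tupleLabel_filter], rfl⟩, ?_, ?_⟩
  · obtain ⟨B, hB, hmem⟩ := exists_multiset_sum_eq_tupleLabel
      (r'.filter fun p => decide (p.2 ≠ 0))
    rw [← hB, ← zero_add B.sum]
    refine LabelledWalk.of_support_eq hwalk .nil B (fun K hK => ?_) (fun e he => .inr ?_)
      fun K hK e he => ?_
    · obtain ⟨p, hp, -, rfl⟩ := (hmem K).1 hK
      obtain ⟨M, hM⟩ := hr'.completeFrom.mem_range
        (List.mem_map_of_mem (List.mem_of_mem_filter hp))
      rw [hM]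
      refine ⟨fun hcon => ?_, O.exists_labelledWalk_step1 M⟩
      obtain ⟨e, he⟩ := List.exists_mem_of_ne_nil _ (O.step1_ne_nil M)
      simpa [cycleLabel_step1, he] using congrFun hcon e
    · rw [Nat.pos_iff_ne_zero, Ne, hz, tupleLabel_eq_zero_iff] at he
      push Not at he
      obtain ⟨p, hp, hp2, hpe⟩ := he
      exact ⟨_, (hmem _).2 ⟨p, hp, hp2, rfl⟩, Nat.pos_of_ne_zero hpe⟩
    · obtain ⟨p, hp, hp2, rfl⟩ := (hmem K).1 hK
      rw [Nat.pos_iff_ne_zero, Ne, hz, tupleLabel_eq_zero_iff]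
      intro hcon
      exact (hcon p hp).elim hp2 he.ne'
  · intro hcon
    exact h0 (funext fun e => (hz e).2 (congrFun hcon e))

theorem Generated.length_le_betti {l : List (Cycle E)} (h : O.Generated l) :
    l.length ≤ G.betti := by
  obtain ⟨full, hfull, hl⟩ := h
  have h1 := hfull.length_le (by simp)
  have h2 := card_isOuter_add O
  have h3 := hl.length_le
  simp only [Finset.card_empty] at h1
  rw [betti, Fintype.card_fin]
  omega

theorem cycleTime_step1_pos (ht : ∀ e, 0 < t e) (M : Finset E) :
    0 < cycleTime t (O.step1 M : Cycle E) := by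
  rw [cycleTime_eq]
  obtain ⟨e, he⟩ := List.exists_mem_of_ne_nil _ (O.step1_ne_nil M)
  exact Finset.sum_pos' (fun f _ => mul_nonneg (Nat.cast_nonneg _) (ht f).le)
    ⟨e, Finset.mem_univ _, by simpa [cycleLabel_step1, he] using ht e⟩

variable {i : ℕ} {d : Fin i → Cycle E}

theorem generated_of_mem_D (hd : d ∈ O.D t i) : O.Generated (List.ofFn d) := by
  simpa [Function.comp_def] using hd.1.1

theorem mem_Icc_of_mem_D (ht : LinearIndependent ℚ t) (hd : d ∈ O.D t i) :
    i ∈ Finset.Icc 1 G.betti := by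
  rw [Finset.mem_Icc]
  refine ⟨Nat.one_le_iff_ne_zero.2 ?_, by simpa using (generated_of_mem_D hd).length_le_betti⟩
  rintro rfl
  have := ((weightedReachable_iff ht).1 hd).2.2
  simp at this

theorem finite_D (O : G.HamiltonianOrder) (t : E → ℝ) (i : ℕ) : (O.D t i).Finite := by
  refine (Set.Finite.pi' fun _ : Fin i =>
    Set.finite_range fun M => (O.step1 M : Cycle E)).subset fun d hd j => ?_
  obtain ⟨M, hM⟩ := (generated_of_mem_D hd).mem_range (List.mem_ofFn.2 ⟨j, rfl⟩)
  exact ⟨M, hM.symm⟩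

theorem cycleTime_pos_of_mem_D (ht : ∀ e, 0 < t e) (hd : d ∈ O.D t i) (j : Fin i) :
    0 < cycleTime t (d j) := by
  obtain ⟨M, hM⟩ := (generated_of_mem_D hd).mem_range (List.mem_ofFn.2 ⟨j, rfl⟩)
  rw [hM]
  exact cycleTime_step1_pos ht M

theorem mem_D_iff (ht : LinearIndependent ℚ t) {m : Fin i → ℕ} (hm : ∀ j, 0 < m j) :
    d ∈ O.D t i ↔ O.WeightedReachable t (List.ofFn fun j => (d j, m j)) := by
  have h : d ∈ O.D t i ↔ O.WeightedReachable t (List.ofFn fun j => (d j, 1)) := by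
    rw [D, Set.mem_ofPred_eq, Reachable, List.map_ofFn]
    rfl
  rw [h]
  exact ⟨fun h => h.of_sameCycles ht (sameCycles_ofFn fun j => by simp [(hm j).ne']),
    fun h => h.of_sameCycles ht (sameCycles_ofFn fun j => by simp [(hm j).ne'])⟩

end Reachable

end HamiltonianOrder

end MultiDigraph

theorem mainTheorem2 {n : ℕ} [NeZero n] {E : Type*} [Fintype E] [DecidableEq E]
    (G : MultiDigraph (Fin n) E) (O : G.HamiltonianOrder)
    (t : E → ℝ) (t_pos : ∀ e, 0 < t e) (t_indep : LinearIndependent ℚ t) (T : ℝ) :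
    {s | s ∈ G.entryTimes t 0 0 ∧ s ≤ T}.Finite ∧
    (∀ i, (O.D t i).Finite) ∧
    (∀ i, ∀ d ∈ O.D t i,
      {m : Fin i → ℕ | (∀ j, 0 < m j) ∧
        ∑ j, (m j : ℝ) * MultiDigraph.cycleTime t (d j) ≤ T}.Finite) ∧
    G.entryCount t 0 0 T =
      ∑ i ∈ Finset.Icc 1 G.betti, ∑ᶠ d ∈ O.D t i,
        {m : Fin i → ℕ | (∀ j, 0 < m j) ∧
          ∑ j, (m j : ℝ) * MultiDigraph.cycleTime t (d j) ≤ T}.ncard := by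
  have hS : {s | s ∈ G.entryTimes t 0 0 ∧ s ≤ T}.Finite := by
    refine ((MultiDigraph.finite_setOf_sum_mul_le t_pos T).image
      fun H => ∑ e, (H e : ℝ) * t e).subset ?_
    rintro s ⟨hs, hsT⟩
    obtain ⟨K, -, -, rfl⟩ := MultiDigraph.exists_labelledWalk_of_entersAt hs
    exact ⟨K, hsT, rfl⟩
  have hF : ∀ i, ∀ d ∈ O.D t i, {m : Fin i → ℕ | (∀ j, 0 < m j) ∧
      ∑ j, (m j : ℝ) * MultiDigraph.cycleTime t (d j) ≤ T}.Finite := fun i d hd =>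
    (MultiDigraph.finite_setOf_sum_mul_le
      (MultiDigraph.HamiltonianOrder.cycleTime_pos_of_mem_D t_pos hd) T).subset fun _ hm => hm.2
  have hD := O.finite_D t
  refine ⟨hS, hD, hF, ?_⟩
  have hg : ∀ i (d : Fin i → Cycle E), ∃ g : Finset (Fin i → ℕ), d ∈ O.D t i →
      (g : Set (Fin i → ℕ)) = {m : Fin i → ℕ | (∀ j, 0 < m j) ∧
        ∑ j, (m j : ℝ) * MultiDigraph.cycleTime t (d j) ≤ T} := fun i d => by
    by_cases hd : d ∈ O.D t i
    · exact ⟨(hF i d hd).toFinset, fun _ => (hF i d hd).coe_toFinset⟩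
    · exact ⟨∅, fun h => absurd h hd⟩
  choose g hg using hg
  have hmem : ∀ {i} {d : Fin i → Cycle E} {m : Fin i → ℕ}, d ∈ O.D t i → (m ∈ g i d ↔
      (∀ j, 0 < m j) ∧ ∑ j, (m j : ℝ) * MultiDigraph.cycleTime t (d j) ≤ T) := fun hd => by
    rw [← Finset.mem_coe, hg _ _ hd, Set.mem_ofPred_eq]
  have hsum : ∀ i, (∑ᶠ d ∈ O.D t i, {m : Fin i → ℕ | (∀ j, 0 < m j) ∧
      ∑ j, (m j : ℝ) * MultiDigraph.cycleTime t (d j) ≤ T}.ncard) =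
      ((hD i).toFinset.sigma fun d => g i d).card := fun i => by
    rw [finsum_mem_eq_finite_toFinset_sum _ (hD i), Finset.card_sigma]
    refine Finset.sum_congr rfl fun d hd => ?_
    rw [← hg i d ((hD i).mem_toFinset.1 hd), Set.ncard_coe_finset]
  simp only [hsum]
  rw [← Finset.card_sigma, MultiDigraph.entryCount, Set.ncard_eq_toFinset_card _ hS]
  symm
  refine Finset.card_bij
    (fun x _ => ∑ j, (x.2.2 j : ℝ) * MultiDigraph.cycleTime t (x.2.1 j)) ?_ ?_ ?_
  · rintro ⟨i, d, m⟩ hx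
    simp only [Finset.mem_sigma, Set.Finite.mem_toFinset] at hx
    obtain ⟨-, hd, hm⟩ := hx
    rw [hmem hd] at hm
    refine hS.mem_toFinset.2 ⟨?_, hm.2⟩
    have := ((MultiDigraph.HamiltonianOrder.mem_D_iff t_indep hm.1).1 hd).2.2
    rwa [MultiDigraph.tupleTime_ofFn] at this
  · rintro ⟨i, d, m⟩ hx ⟨i', d', m'⟩ hx' heq
    simp only [Finset.mem_sigma, Set.Finite.mem_toFinset] at hx hx'
    obtain ⟨-, hd, hm⟩ := hx
    obtain ⟨-, hd', hm'⟩ := hx'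
    rw [hmem hd] at hm
    rw [hmem hd'] at hm'
    have h1 := ((MultiDigraph.HamiltonianOrder.mem_D_iff t_indep hm.1).1 hd).2.1
    have h2 := ((MultiDigraph.HamiltonianOrder.mem_D_iff t_indep hm'.1).1 hd').2.1
    rw [MultiDigraph.tupleTime_ofFn] at h1 h2
    have hl := h1.eq t_indep (heq ▸ h2)
    obtain rfl : i = i' := by simpa using congrArg List.length hl
    have hj := fun j => congrFun (List.ofFn_injective hl) j
    simp only [Prod.mk.injEq] at hj
    obtain rfl : d = d' := funext fun j => (hj j).1
    obtain rfl : m = m' := funext fun j => (hj j).2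
    rfl
  · intro s hs
    obtain ⟨hs, hsT⟩ := hS.mem_toFinset.1 hs
    obtain ⟨c, hc, rfl⟩ := O.exists_weightedReachable t_indep hs
    have hofFn : (List.ofFn fun j : Fin c.length => ((c.get j).1, (c.get j).2)) = c :=
      List.ofFn_get c
    have hpos : ∀ j : Fin c.length, 0 < (c.get j).2 := fun j => hc.1.2 _ (List.get_mem c j)
    have hd : (fun j => (c.get j).1) ∈ O.D t c.length := by
      rw [MultiDigraph.HamiltonianOrder.mem_D_iff t_indep hpos, hofFn]
      exact hc
    have htime := MultiDigraph.tupleTime_ofFn t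
      (fun j => (c.get j).1) fun j => (c.get j).2
    rw [hofFn] at htime
    refine ⟨⟨c.length, fun j => (c.get j).1, fun j => (c.get j).2⟩, ?_, htime.symm⟩
    simp only [Finset.mem_sigma, Set.Finite.mem_toFinset]
    exact ⟨MultiDigraph.HamiltonianOrder.mem_Icc_of_mem_D t_indep hd, hd,
      (hmem hd).2 ⟨hpos, htime ▸ hsT⟩⟩
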